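/- Let $(P,\preceq)$ be a finite poset with a greatest element $\hat 1$, $n=|P|$, identified with $\{1,\dots,n\}$ by a natural labeling (i.e. $a\prec b$ implies $a<b$), and let $\hat P=P\cup\{0\}$ be obtained by adjoining a minimum $0$. Let $h(P)$ be the number of elements of a longest chain of $P$. The Lipschitz polytope $\mathrm{Lip}(P)\subset\mathbb R^P$ is the set of $f$ which, extended by $f(0)=0$, are nonnegative and isotone on $\hat P$ and satisfy $f(b)-f(a)\le d(a,b)$ for all $a\preceq b$ in $\hat P$, where $d(a,b)$ is the minimal length of a saturated chain from $a$ to $b$; that is, $0\le f(b)-f(a)\le 1$ for all cover relations $a\prec\!\!\cdot\, b$ of $\hat P$. For $\tau\in\mathfrak S_n$ put $\tau(0)=0$. Call $\tau$ descent-compatible, $\tau\in\mathrm{DC}(P)$, if for each $a\in P$ the number of descents of the word $\tau(c_0)\tau(c_1)\cdots\tau(c_m)$ is the same for all saturated chains $0=c_0\prec\!\!\cdot\, c_1\prec\!\!\cdot\cdots\prec\!\!\cdot\, c_m=a$ in $\hat P$; this number is $\mathrm{des}_{P,\tau}(a)$, with $\mathrm{des}_{P,\tau}(0)=0$, and $\mathrm{des}_P(\tau)=\mathrm{des}_{P,\tau}(\hat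 1)$. Let $\mathrm{stat}_P(\tau)$ be the number of pairs $(a,b)\in\hat P\times\hat P$ with $\tau(a)=\tau(b)-1$ such that either $\mathrm{des}_{P,\tau}(a)<\mathrm{des}_{P,\tau}(b)$, or $\mathrm{des}_{P,\tau}(a)=\mathrm{des}_{P,\tau}(b)$ and $a>b$ as labels. For a set $S\subset\mathbb R^P$ such that $|tS\cap\mathbb Z^P|=L(t)$ for all integers $t\ge1$ and some polynomial $L$, let $h^*(S,z)=(1-z)^{n+1}\sum_{t\ge0}L(t)z^t$. Then for every integer $k$ with $2\le k\le h(P)$, the half-open $(P,k)$-hypersimplex satisfies $$h^*\bigl(\{f\in\mathrm{Lip}(P): k-1<f(\hat 1)\le k\},z\bigr)=\sum_{\tau\in\mathrm{DC}(P),\ \mathrm{des}_P(\tau)=k-1}z^{\mathrm{stat}_P(\tau)},$$ and for $k=1$ the closed hypersimplex satisfies $$h^*\bigl(\{f\in\mathrm{Lip}(P): 0\le f(\hat 1)\le 1\},z\bigr)=\sum_{\tau\in\mathrm{DC}(P),\ \mathrm{des}_P(\tau)=0}z^{\mathrm{stat}_P(\tau)}.$$ (It is part of the claim that the Ehrhart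 counting functions of these sets are polynomials.) -/

import Mathlib

open scoped Pointwise

/-- Saturated (unrefinable) chains in a partially ordered set: finite sequences
`c 0 ⋖ c 1 ⋖ ⋯ ⋖ c m`, where `m` is the `length`, `c 0` the `head` and `c m` the `last`. -/
abbrev SatChain (α : Type*) [PartialOrder α] : Type _ :=
  RelSeries {(a, b) : α × α | a ⋖ b}

/-- The minimal length of a saturated chain from `a` to `b` (only used for `a ≤ b` in a finite
poset, where such a chain exists). -/
noncomputable def satDist {α : Type*} [PartialOrder α] (a b : α) : ℕ :=
  sInf {m : ℕ | ∃ c : SatChain α, c.head = a ∧ c.last = b ∧ c.length = m}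

/-- Isotone functions that are `1`-Lipschitz for the quasi-metric `satDist`. -/
def IsPosetLipschitz {α : Type*} [PartialOrder α] (f : α → ℝ) : Prop :=
  Monotone f ∧ ∀ a b : α, a ≤ b → f b - f a ≤ (satDist a b : ℝ)

/-- Extension of a function on `P` by the value `0` at the adjoined minimum `⊥`. -/
def extendZero {P : Type*} {R : Type*} [Zero R] (f : P → R) : WithBot P → R
  | ⊥ => 0
  | (a : P) => f a

/-- The Lipschitz polytope of `P`, in the coordinates `ℝ^P`: the functions whose extension by
`0` at the adjoined minimum is isotone, nonnegative and Lipschitz. -/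
def lipPolytope (P : Type*) [PartialOrder P] : Set (P → ℝ) :=
  {f | (∀ x : WithBot P, 0 ≤ extendZero f x) ∧ IsPosetLipschitz (extendZero f)}

/-- The (closed) `(P, k)`-hypersimplex. -/
def hypersimplex (P : Type*) [PartialOrder P] [OrderTop P] (k : ℕ) : Set (P → ℝ) :=
  {f ∈ lipPolytope P | (k : ℝ) - 1 ≤ f ⊤ ∧ f ⊤ ≤ k}

/-- The half-open `(P, k)`-hypersimplex. -/
def halfOpenHypersimplex (P : Type*) [PartialOrder P] [OrderTop P] (k : ℕ) : Set (P → ℝ) :=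
  {f ∈ lipPolytope P | (k : ℝ) - 1 < f ⊤ ∧ f ⊤ ≤ k}

/-- The height of a poset with greatest element: the number of elements of a longest chain
(`Order.height ⊤` counts the steps of a longest chain ending in `⊤`). -/
noncomputable def posetHeight (P : Type*) [PartialOrder P] [OrderTop P] : ℕ∞ :=
  Order.height (⊤ : P) + 1

section Permutations

variable {P : Type*} [PartialOrder P] {n : ℕ}

/-- The value in `{0, 1, …, n}` attached to an element of `WithBot P` by a labeling of `P`:
the adjoined minimum gets `0`, and `Fin n` is shifted to `{1, …, n}`. -/
def hatLabel (ℓ : P → Fin n) : WithBot P → ℕ :=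
  extendZero fun a => (ℓ a : ℕ) + 1

/-- For a labeling `ω` of `P` by `{1, …, n}`, the value `τ(a)` of a permutation `τ` at an
element of `WithBot P`, with `τ(0) = 0`. -/
def permVal (ω : P ≃ Fin n) (τ : Equiv.Perm (Fin n)) : WithBot P → ℕ :=
  hatLabel fun a => τ (ω a)

/-- The number of descents of the word `τ(c 0) τ(c 1) ⋯ τ(c m)`. -/
def chainDes (ω : P ≃ Fin n) (τ : Equiv.Perm (Fin n)) (c : SatChain (WithBot P)) : ℕ :=
  (Finset.univ.filter fun i : Fin c.length =>
    permVal ω τ (c i.castSucc) > permVal ω τ (c i.succ)).card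

/-- `τ` is descent-compatible: the number of descents along a saturated chain from the adjoined
minimum to `a` depends on `a` only. -/
def IsDescentCompatible (ω : P ≃ Fin n) (τ : Equiv.Perm (Fin n)) : Prop :=
  ∀ (a : P) (c d : SatChain (WithBot P)), c.head = ⊥ → c.last = a → d.head = ⊥ → d.last = a →
    chainDes ω τ c = chainDes ω τ d

/-- The number of descents along a saturated chain from the adjoined minimum to `x`. For
descent-compatible `τ` all these chains have the same number of descents, which is then the value
of the infimum. -/
noncomputable def desAt (ω : P ≃ Fin n) (τ : Equiv.Perm (Fin n)) (x : WithBot P) : ℕ :=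
  sInf {m : ℕ | ∃ c : SatChain (WithBot P), c.head = ⊥ ∧ c.last = x ∧ chainDes ω τ c = m}

/-- The number of `P`-descents of a permutation. -/
noncomputable def posetDes [OrderTop P] (ω : P ≃ Fin n) (τ : Equiv.Perm (Fin n)) : ℕ :=
  desAt ω τ ((⊤ : P) : WithBot P)

/-- The statistic `stat_P(τ)`: the number of pairs `(a, b)` of elements of `WithBot P` with
`τ(a) = τ(b) - 1` such that `a` has fewer descents than `b`, or as many while `a > b` in the
labeling. -/
noncomputable def posetStat (ω : P ≃ Fin n) (τ : Equiv.Perm (Fin n)) : ℕ :=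
  Set.ncard {p : WithBot P × WithBot P |
    permVal ω τ p.1 + 1 = permVal ω τ p.2 ∧
      (desAt ω τ p.1 < desAt ω τ p.2 ∨
        (desAt ω τ p.1 = desAt ω τ p.2 ∧ hatLabel ω p.2 < hatLabel ω p.1))}

open Classical in
/-- The descent-compatible permutations with exactly `j` `P`-descents. -/
noncomputable def descentClass [OrderTop P] (ω : P ≃ Fin n) (j : ℕ) :
    Finset (Equiv.Perm (Fin n)) :=
  Finset.univ.filter fun τ => IsDescentCompatible ω τ ∧ posetDes ω τ = j

end Permutations

/-- The integer points of the `t`-th dilate of `S`. -/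
def dilateLatticePoints {ι : Type*} (S : Set (ι → ℝ)) (t : ℕ) : Set (ι → ℤ) :=
  {v | (fun i => (v i : ℝ)) ∈ (t : ℝ) • S}

/-- `L` is the Ehrhart polynomial of `S`: it counts the integer points of the positive integral
dilates of `S`. This determines `L`. -/
def IsEhrhartPolynomial {ι : Type*} (S : Set (ι → ℝ)) (L : Polynomial ℚ) : Prop :=
  ∀ t : ℕ, 1 ≤ t → (dilateLatticePoints S t).Finite ∧
    ((dilateLatticePoints S t).ncard : ℚ) = L.eval (t : ℚ)

/-- `h` is the `h^*`-polynomial of `S ⊆ ℝ^ι`: with `L` the Ehrhart polynomial of `S` and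
`n = |ι|`, one has `h(z) = (1 - z)^(n + 1) * ∑_{t ≥ 0} L(t) z^t`. For a nonempty closed lattice
polytope `L(0) = 1`; for a half-open one the term `t = 0` is given by the polynomial `L`. -/
def IsHStarPolynomial {ι : Type*} [Fintype ι] (S : Set (ι → ℝ)) (h : Polynomial ℚ) : Prop :=
  ∃ L : Polynomial ℚ, IsEhrhartPolynomial S L ∧
    (h : PowerSeries ℚ) =
      (1 - PowerSeries.X) ^ (Fintype.card ι + 1) * PowerSeries.mk fun t => L.eval (t : ℚ)

/-! Divide a lattice point `v` of the `t`-th dilate of the Lipschitz polytope by `t`: `v a = t * q a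
+ r a` with `0 < r a ≤ t`, or `q a = r a = 0` when `v a = 0`. Sort the elements of `WithBot P` by
increasing `r`, ties by decreasing `q`, then by increasing label. This defines a permutation `τ`.
For a cover `a ⋖ b` the condition `0 ≤ v b - v a ≤ t` forces `q b - q a` to be 0 or 1, and it is 1
exactly when `τ` descends from `a` to `b` (`IsLatticeLipschitz.quot_step`). Hence `τ` is
descent-compatible and `q` is its descent function.

Conversely, fix a descent-compatible `τ`. The points sorted by `τ` have `q = desAt ω τ`, and their
remainders, read along the word of `τ`, form a sequence in `[0, t]` which must increase strictly at
exactly the steps counted by `posetStat` and weakly elsewhere (`isSortedBy_iff_mem_image`). There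
are `(t + n - posetStat ω τ).choose n` such sequences (`ncard_boundedSeqs`), with generating
function `z ^ posetStat ω τ / (1 - z) ^ (n + 1)`. The slice `k - 1 < f ⊤ ≤ k` (closed below when `k
= 1`) is the condition `q ⊤ = k - 1`, so summing over `τ` gives the theorem. -/

/-! ### Counting sequences with prescribed strict steps -/

section Counting

variable {n : ℕ}

/-- Integer sequences `0 ≤ x 0 ≤ ⋯ ≤ x (n - 1) ≤ t` where the step into each position of `S` is
strict (the step into position `0` starts at the value `0`). -/
def boundedSeqs (S : Finset (Fin n)) (t : ℤ) : Set (Fin n → ℤ) :=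
  {x | (∀ i : Fin n, (Fin.cons 0 x : Fin (n + 1) → ℤ) i.castSucc ≤ x i ∧
      (i ∈ S → (Fin.cons 0 x : Fin (n + 1) → ℤ) i.castSucc < x i)) ∧
    (Fin.cons 0 x : Fin (n + 1) → ℤ) (Fin.last n) ≤ t}

/-- The number of steps outside `S` before position `j`. -/
def weakStepsBefore (S : Finset (Fin n)) (j : Fin (n + 1)) : ℕ :=
  (Finset.univ.filter fun i : Fin n => i ∉ S ∧ i.castSucc < j).card

lemma weakStepsBefore_zero (S : Finset (Fin n)) : weakStepsBefore S 0 = 0 := by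
  simp [weakStepsBefore]

lemma weakStepsBefore_last (S : Finset (Fin n)) :
    weakStepsBefore S (Fin.last n) = n - S.card := by
  have : (Finset.univ.filter fun i : Fin n => i ∉ S ∧ i.castSucc < Fin.last n) = Sᶜ := by
    ext i; simp [Fin.castSucc_lt_last]
  rw [weakStepsBefore, this, Finset.card_compl, Fintype.card_fin]

lemma weakStepsBefore_succ (S : Finset (Fin n)) (i : Fin n) :
    weakStepsBefore S i.succ = weakStepsBefore S i.castSucc + if i ∈ S then 0 else 1 := by
  unfold weakStepsBefore
  split_ifs with h
  · rw [add_zero]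
    congr 1
    ext j
    simp only [Finset.mem_filter, Finset.mem_univ, true_and, Fin.castSucc_lt_succ_iff,
      Fin.castSucc_lt_castSucc_iff]
    constructor
    · rintro ⟨h1, h2⟩
      exact ⟨h1, lt_of_le_of_ne h2 (by rintro rfl; exact h1 h)⟩
    · rintro ⟨h1, h2⟩
      exact ⟨h1, h2.le⟩
  · rw [← Finset.card_insert_of_notMem (a := i) (by simp)]
    congr 1
    ext j
    simp only [Finset.mem_filter, Finset.mem_univ, true_and, Fin.castSucc_lt_succ_iff,
      Fin.castSucc_lt_castSucc_iff, Finset.mem_insert]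
    constructor
    · rintro ⟨h1, h2⟩
      rcases h2.eq_or_lt with h3 | h3
      · exact Or.inl h3
      · exact Or.inr ⟨h1, h3⟩
    · rintro (rfl | ⟨h1, h2⟩)
      · exact ⟨h, le_rfl⟩
      · exact ⟨h1, h2.le⟩

/-- Adding to each term the number of preceding weak steps makes every step strict. The `n - S.card`
weak steps raise the upper bound by that amount. -/
lemma mem_boundedSeqs_iff (S : Finset (Fin n)) (t : ℕ) (x : Fin n → ℤ) :
    x ∈ boundedSeqs S t ↔
      StrictMono (fun j => (Fin.cons 0 x : Fin (n + 1) → ℤ) j + weakStepsBefore S j) ∧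
      (Fin.cons 0 x : Fin (n + 1) → ℤ) (Fin.last n) + weakStepsBefore S (Fin.last n) ≤
        ((t + n - S.card : ℕ) : ℤ) := by
  have hS : S.card ≤ n := by simpa using S.card_le_univ
  rw [Fin.strictMono_iff_lt_succ, weakStepsBefore_last, boundedSeqs, Set.mem_ofPred_eq]
  refine and_congr (forall_congr' fun i => ?_) ?_
  · rw [weakStepsBefore_succ, Fin.cons_succ]
    by_cases h : i ∈ S <;> simp [h] <;> omega
  · omega

lemma strictMono_cons_zero (s : Finset ℤ) (hs : s.card = n) (hpos : ∀ a ∈ s, 1 ≤ a) :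
    StrictMono (Fin.cons 0 (s.orderEmbOfFin hs) : Fin (n + 1) → ℤ) := by
  intro i j hij
  induction j using Fin.cases with
  | zero => exact absurd hij (Fin.not_lt_zero i)
  | succ j =>
    induction i using Fin.cases with
    | zero =>
      have := hpos _ (s.orderEmbOfFin_mem hs j)
      rw [Fin.cons_zero, Fin.cons_succ]
      omega
    | succ i =>
      rw [Fin.cons_succ, Fin.cons_succ]
      exact (s.orderEmbOfFin hs).strictMono (Fin.succ_lt_succ_iff.mp hij)

/-- After the shift, a sequence is a strictly increasing one in `[1, m]`, which is determined by its
set of values, an arbitrary `n`-subset. -/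
lemma ncard_boundedSeqs (S : Finset (Fin n)) (t : ℕ) :
    (boundedSeqs S t).Finite ∧ (boundedSeqs S t).ncard = (t + n - S.card).choose n := by
  set m := t + n - S.card
  have hcard : (((Finset.powersetCard n (Finset.Icc (1 : ℤ) m) : Finset (Finset ℤ)) :
      Set (Finset ℤ))).ncard = m.choose n := by
    rw [Set.ncard_coe_finset, Finset.card_powersetCard]
    simp
  have hbij : Set.BijOn (fun x : Fin n → ℤ =>
      Finset.univ.image fun i => x i + (weakStepsBefore S i.succ : ℤ))
      (boundedSeqs S t) (Finset.powersetCard n (Finset.Icc (1 : ℤ) m) : Finset (Finset ℤ)) := by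
    have hmono : ∀ x ∈ boundedSeqs S t,
        StrictMono fun i : Fin n => x i + (weakStepsBefore S i.succ : ℤ) := by
      intro x hx i j hij
      have := ((mem_boundedSeqs_iff S t x).1 hx).1 (Fin.succ_lt_succ_iff.mpr hij)
      simpa using this
    refine ⟨?_, ?_, ?_⟩
    · intro x hx
      obtain ⟨h1, h2⟩ := (mem_boundedSeqs_iff S t x).1 hx
      rw [Finset.mem_coe, Finset.mem_powersetCard]
      constructor
      · intro a ha
        obtain ⟨i, -, rfl⟩ := Finset.mem_image.1 ha
        have h3 := h1 (Fin.succ_pos i)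
        have h4 := h1.monotone (Fin.le_last i.succ)
        simp only [Fin.cons_zero, weakStepsBefore_zero, Fin.cons_succ] at h3 h4
        rw [Finset.mem_Icc]
        constructor
        · push_cast at h3; omega
        · exact h4.trans h2
      · rw [Finset.card_image_of_injective _ (hmono x hx).injective]
        simp
    · intro x hx y hy hxy
      have hc : (Finset.univ.image fun i => x i + (weakStepsBefore S i.succ : ℤ)).card = n := by
        rw [Finset.card_image_of_injective _ (hmono x hx).injective]
        simp
      have e1 := Finset.orderEmbOfFin_unique hc (fun i => Finset.mem_image_of_mem _
        (Finset.mem_univ i)) (hmono x hx)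
      have e2 := Finset.orderEmbOfFin_unique hc (fun i => by
        simp only at hxy
        rw [hxy]
        exact Finset.mem_image_of_mem _ (Finset.mem_univ i)) (hmono y hy)
      funext i
      have := congrFun (e1.trans e2.symm) i
      simpa using this
    · intro s hs
      rw [Finset.mem_coe, Finset.mem_powersetCard] at hs
      obtain ⟨hsub, hc⟩ := hs
      have hcons : (fun j => (Fin.cons 0 (fun i => s.orderEmbOfFin hc i -
          (weakStepsBefore S i.succ : ℤ)) : Fin (n + 1) → ℤ) j + (weakStepsBefore S j : ℤ)) =
          (Fin.cons 0 (s.orderEmbOfFin hc) : Fin (n + 1) → ℤ) := by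
        funext j
        induction j using Fin.cases with
        | zero => simp [weakStepsBefore_zero]
        | succ j => simp
      refine ⟨fun i => s.orderEmbOfFin hc i - (weakStepsBefore S i.succ : ℤ), ?_, ?_⟩
      · rw [mem_boundedSeqs_iff]
        refine ⟨?_, ?_⟩
        · rw [hcons]
          exact strictMono_cons_zero s hc fun a ha => (Finset.mem_Icc.1 (hsub ha)).1
        · rw [congrFun hcons (Fin.last n)]
          have : ∀ j, (Fin.cons 0 (s.orderEmbOfFin hc) : Fin (n + 1) → ℤ) j ≤ m := by
            intro j
            induction j using Fin.cases with
            | zero => simp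
            | succ j =>
              rw [Fin.cons_succ]
              exact (Finset.mem_Icc.1 (hsub (s.orderEmbOfFin_mem hc j))).2
          exact this _
      · ext a
        simp only [sub_add_cancel, Finset.mem_image, Finset.mem_univ, true_and]
        exact Set.ext_iff.1 (Finset.range_orderEmbOfFin s hc) a
  constructor
  · exact Set.Finite.of_injOn hbij.mapsTo hbij.injOn (Finset.finite_toSet _)
  · rw [← hcard, ← hbij.image_eq, hbij.injOn.ncard_image]

end Counting

/-! ### From binomial counts to powers of `z` -/

section GeneratingFunction

/-- The polynomial whose value at a natural number `t` is `(t + n - s).choose n`. -/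
noncomputable def shiftedChoosePoly (n s : ℕ) : Polynomial ℚ :=
  Polynomial.C ((n.factorial : ℚ)⁻¹) *
    (descPochhammer ℚ n).comp (Polynomial.X + Polynomial.C ((n - s : ℕ) : ℚ))

lemma eval_shiftedChoosePoly {n s : ℕ} (hs : s ≤ n) (t : ℕ) :
    (shiftedChoosePoly n s).eval (t : ℚ) = ((t + n - s).choose n : ℕ) := by
  rw [shiftedChoosePoly, Nat.cast_choose_eq_descPochhammer_div, Nat.add_sub_assoc hs]
  simp
  ring

lemma one_sub_X_pow_mul_mk_choose {n s : ℕ} (hs : s ≤ n) :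
    (1 - PowerSeries.X : PowerSeries ℚ) ^ (n + 1) *
      PowerSeries.mk (fun t => (shiftedChoosePoly n s).eval (t : ℚ)) = PowerSeries.X ^ s := by
  have h1 : PowerSeries.mk (fun t => (shiftedChoosePoly n s).eval (t : ℚ)) =
      PowerSeries.X ^ s * PowerSeries.mk fun t => (((n + t).choose n : ℕ) : ℚ) := by
    ext t
    rw [PowerSeries.coeff_X_pow_mul', PowerSeries.coeff_mk, eval_shiftedChoosePoly hs]
    split_ifs with h
    · rw [PowerSeries.coeff_mk]
      congr 2
      omega
    -- For `t < s` the upper index is below `n`, so the first `s` coefficients vanish.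
    · rw [Nat.choose_eq_zero_of_lt (by omega)]
      simp
  have h2 : (PowerSeries.mk fun t => (((n + t).choose n : ℕ) : ℚ)) *
      (1 - PowerSeries.X : PowerSeries ℚ) ^ (n + 1) = 1 := by
    rw [← PowerSeries.mk_one_pow_eq_mk_choose_add, ← mul_pow,
      PowerSeries.mk_one_mul_one_sub_eq_one, one_pow]
  rw [h1, mul_left_comm, mul_comm (_ ^ (n + 1)), h2, mul_one]

/-- If the integer points of the positive dilates of `S` are partitioned into finitely many pieces,
indexed by `σ` and counted by `(t + n - s σ).choose n`, then the `h^*`-polynomial of `S` is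
`∑ z ^ s σ`. -/
lemma isHStarPolynomial_of_ncard {ι σ : Type*} [Fintype ι] (A : Set (ι → ℝ)) (D : Finset σ)
    (s : σ → ℕ) (hs : ∀ τ ∈ D, s τ ≤ Fintype.card ι)
    (hA : ∀ t : ℕ, 1 ≤ t → (dilateLatticePoints A t).Finite ∧
      (dilateLatticePoints A t).ncard =
        ∑ τ ∈ D, (t + Fintype.card ι - s τ).choose (Fintype.card ι)) :
    IsHStarPolynomial A (∑ τ ∈ D, (Polynomial.X : Polynomial ℚ) ^ s τ) := by
  refine ⟨∑ τ ∈ D, shiftedChoosePoly (Fintype.card ι) (s τ), fun t ht => ⟨(hA t ht).1, ?_⟩, ?_⟩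
  · rw [(hA t ht).2, Polynomial.eval_finsetSum]
    push_cast
    exact Finset.sum_congr rfl fun τ hτ => (eval_shiftedChoosePoly (hs τ hτ) t).symm
  · have : PowerSeries.mk (fun t : ℕ =>
        (∑ τ ∈ D, shiftedChoosePoly (Fintype.card ι) (s τ)).eval (t : ℚ)) =
        ∑ τ ∈ D, PowerSeries.mk
          (fun t : ℕ => (shiftedChoosePoly (Fintype.card ι) (s τ)).eval (t : ℚ)) := by
      ext t
      simp [Polynomial.eval_finsetSum]
    rw [this, Finset.mul_sum, ← Polynomial.coeToPowerSeries.ringHom_apply, map_sum]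
    refine Finset.sum_congr rfl fun τ hτ => ?_
    rw [one_sub_X_pow_mul_mk_choose (hs τ hτ)]
    simp

end GeneratingFunction

/-! ### Telescoping along saturated chains -/

section Chains

lemma Fin.sum_succ_sub_castSucc {G : Type*} [AddCommGroup G] {m : ℕ} (f : Fin (m + 1) → G) :
    ∑ i : Fin m, (f i.succ - f i.castSucc) = f (Fin.last m) - f 0 := by
  induction m with
  | zero => simp
  | succ m ih =>
    rw [Fin.sum_univ_castSucc]
    have := ih fun i => f i.castSucc
    simp only [Fin.castSucc_zero] at this
    simp only [← Fin.castSucc_succ] at this ⊢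
    rw [this, Fin.succ_last]
    abel

lemma exists_satChain {α : Type*} [PartialOrder α] [Finite α] {a b : α} (h : a ≤ b) :
    ∃ c : SatChain α, c.head = a ∧ c.last = b := by
  obtain ⟨f, h0, m, hm, hf⟩ := exists_covBy_seq_of_wellFoundedLT_wellFoundedGT_of_le h
  exact ⟨⟨m, fun i => f i, fun i => hf i i.2⟩, h0, hm⟩

/-- A cover has distance at most 1. Conversely, the cover inequalities are summed along a saturated
chain, of minimal length for the Lipschitz bound. -/
lemma isPosetLipschitz_iff {α : Type*} [PartialOrder α] [Finite α] (f : α → ℝ) :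
    IsPosetLipschitz f ↔ ∀ a b : α, a ⋖ b → 0 ≤ f b - f a ∧ f b - f a ≤ 1 := by
  constructor
  · rintro ⟨h1, h2⟩ a b hab
    refine ⟨sub_nonneg.2 (h1 hab.le), (h2 a b hab.le).trans ?_⟩
    have : satDist a b ≤ 1 :=
      Nat.sInf_le ⟨⟨1, ![a, b], fun i => by simpa [Subsingleton.elim i 0] using! hab⟩, rfl, rfl, rfl⟩
    exact_mod_cast this
  · intro h
    have key : ∀ c : SatChain α,
        f c.last - f c.head = ∑ i : Fin c.length, (f (c i.succ) - f (c i.castSucc)) :=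
      fun c => (Fin.sum_succ_sub_castSucc fun i => f (c i)).symm
    constructor
    · intro a b hab
      obtain ⟨c, rfl, rfl⟩ := exists_satChain hab
      rw [← sub_nonneg, key]
      exact Finset.sum_nonneg fun i _ => (h _ _ (c.step i)).1
    · intro a b hab
      have hne : {m : ℕ | ∃ c : SatChain α, c.head = a ∧ c.last = b ∧ c.length = m}.Nonempty := by
        obtain ⟨c, h1, h2⟩ := exists_satChain hab
        exact ⟨_, c, h1, h2, rfl⟩
      obtain ⟨c, rfl, rfl, hl⟩ := Nat.sInf_mem hne
      rw [satDist, ← hl, key]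
      refine (Finset.sum_le_sum fun i _ => (h _ _ (c.step i)).2).trans ?_
      simp

end Chains

/-! ### Lattice points of dilates -/

section LatticePoints

variable {P : Type*}

@[simp] lemma extendZero_bot {R : Type*} [Zero R] (f : P → R) : extendZero f ⊥ = 0 := rfl

@[simp] lemma extendZero_coe {R : Type*} [Zero R] (f : P → R) (a : P) :
    extendZero f (a : WithBot P) = f a := rfl

variable [PartialOrder P]

/-- Integer points of the `t`-th dilate of the Lipschitz polytope, described by cover relations. -/
def IsLatticeLipschitz (t : ℕ) (v : P → ℤ) : Prop :=
  ∀ a b : WithBot P, a ⋖ b →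
    0 ≤ extendZero v b - extendZero v a ∧ extendZero v b - extendZero v a ≤ t

lemma inv_smul_mem_lipPolytope_iff [Finite P] {t : ℕ} (ht : 1 ≤ t) (v : P → ℤ) :
    ((t : ℝ)⁻¹ • fun i => (v i : ℝ)) ∈ lipPolytope P ↔ IsLatticeLipschitz t v := by
  have ht0 : (0 : ℝ) < t := by exact_mod_cast ht
  have hext : ∀ x : WithBot P, extendZero ((t : ℝ)⁻¹ • fun i => (v i : ℝ)) x =
      ((extendZero v x : ℤ) : ℝ) / t := by
    intro x
    cases x with
    | bot => simp
    | coe a => simp [div_eq_inv_mul]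
  have hfin : Finite (WithBot P) := inferInstanceAs (Finite (Option P))
  have hcov : IsPosetLipschitz (extendZero ((t : ℝ)⁻¹ • fun i => (v i : ℝ))) ↔
      IsLatticeLipschitz t v := by
    rw [isPosetLipschitz_iff, IsLatticeLipschitz]
    refine forall₃_congr fun a b _ => ?_
    rw [hext, hext, ← sub_div, div_le_one ht0, le_div_iff₀ ht0, zero_mul]
    norm_cast
  constructor
  · exact fun h => hcov.1 h.2
  · intro h
    have := hcov.2 h
    exact ⟨fun x => by simpa using this.1 (bot_le : ⊥ ≤ x), this⟩

lemma mem_dilateLatticePoints_iff {ι : Type*} (A : Set (ι → ℝ)) {t : ℕ} (ht : 1 ≤ t)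
    (v : ι → ℤ) :
    v ∈ dilateLatticePoints A t ↔ ((t : ℝ)⁻¹ • fun i => (v i : ℝ)) ∈ A :=
  Set.mem_smul_set_iff_inv_smul_mem₀ (by positivity) A _

end LatticePoints

/-! ### Descent functions as potentials -/

section Descents

variable {P : Type*} [PartialOrder P] {n : ℕ} (ω : P ≃ Fin n) (τ : Equiv.Perm (Fin n))

/-- The contribution of a step from `a` to `b` to the number of descents. -/
def desStep (a b : WithBot P) : ℕ :=
  if permVal ω τ b < permVal ω τ a then 1 else 0

lemma chainDes_eq_sum (c : SatChain (WithBot P)) :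
    chainDes ω τ c = ∑ i : Fin c.length, desStep ω τ (c i.castSucc) (c i.succ) := by
  rw [chainDes, Finset.card_filter]
  rfl

variable {ω τ}

/-- If `q` grows by the descent indicator along covers, the descent count telescopes and depends
only on the endpoints of the chain. -/
lemma chainDes_eq_sub {q : WithBot P → ℤ}
    (hq : ∀ a b : WithBot P, a ⋖ b → q b = q a + desStep ω τ a b) (c : SatChain (WithBot P)) :
    (chainDes ω τ c : ℤ) = q c.last - q c.head := by
  rw [chainDes_eq_sum]
  refine Eq.trans ?_ (Fin.sum_succ_sub_castSucc fun i => q (c i))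
  push_cast
  refine Finset.sum_congr rfl fun i _ => ?_
  rw [hq _ _ (c.step i)]
  ring

lemma isDescentCompatible_of_step {q : WithBot P → ℤ}
    (hq : ∀ a b : WithBot P, a ⋖ b → q b = q a + desStep ω τ a b) :
    IsDescentCompatible ω τ := by
  intro a c d hc hc' hd hd'
  have h1 := chainDes_eq_sub hq c
  have h2 := chainDes_eq_sub hq d
  rw [hc, hc'] at h1
  rw [hd, hd'] at h2
  exact_mod_cast h1.trans h2.symm

lemma exists_chainDes_eq_desAt [Finite P] (x : WithBot P) :
    ∃ c : SatChain (WithBot P), c.head = ⊥ ∧ c.last = x ∧ chainDes ω τ c = desAt ω τ x := by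
  have hfin : Finite (WithBot P) := inferInstanceAs (Finite (Option P))
  have hne : {m : ℕ | ∃ c : SatChain (WithBot P),
      c.head = ⊥ ∧ c.last = x ∧ chainDes ω τ c = m}.Nonempty := by
    obtain ⟨c, h1, h2⟩ := exists_satChain (bot_le : ⊥ ≤ x)
    exact ⟨_, c, h1, h2, rfl⟩
  exact Nat.sInf_mem hne

lemma desAt_eq_of_step [Finite P] {q : WithBot P → ℤ} (h0 : q ⊥ = 0)
    (hq : ∀ a b : WithBot P, a ⋖ b → q b = q a + desStep ω τ a b) (x : WithBot P) :
    (desAt ω τ x : ℤ) = q x := by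
  obtain ⟨c, h1, h2, h3⟩ := exists_chainDes_eq_desAt (ω := ω) (τ := τ) x
  rw [← h3, chainDes_eq_sub hq, h1, h2, h0, sub_zero]

variable (ω τ) in
lemma desAt_bot : desAt ω τ ⊥ = 0 := by
  refine Nat.eq_zero_of_le_zero (Nat.sInf_le ⟨RelSeries.singleton _ ⊥, rfl, rfl, ?_⟩)
  rw [chainDes_eq_sum]
  exact Finset.sum_empty

lemma chainDes_snoc (c : SatChain (WithBot P)) (b : WithBot P) (h : c.last ⋖ b) :
    chainDes ω τ (c.snoc b h) = chainDes ω τ c + desStep ω τ c.last b := by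
  rw [chainDes_eq_sum, chainDes_eq_sum]
  refine (Fin.sum_univ_castSucc (n := c.length) fun i =>
    desStep ω τ ((c.snoc b h) i.castSucc) ((c.snoc b h) i.succ)).trans ?_
  congr 1
  · refine Finset.sum_congr rfl fun i _ => ?_
    rw [Fin.succ_castSucc]
    erw [RelSeries.snoc_castSucc, RelSeries.snoc_castSucc]
  · erw [RelSeries.snoc_castSucc, Fin.succ_last, RelSeries.last_snoc']
    rfl

lemma IsDescentCompatible.desAt_step [Finite P] (hτ : IsDescentCompatible ω τ) {a b : WithBot P}
    (hab : a ⋖ b) : desAt ω τ b = desAt ω τ a + desStep ω τ a b := by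
  obtain ⟨c, h1, rfl, h3⟩ := exists_chainDes_eq_desAt (ω := ω) (τ := τ) a
  obtain ⟨d, h4, h5, h6⟩ := exists_chainDes_eq_desAt (ω := ω) (τ := τ) b
  cases b with
  | bot => exact absurd hab.lt not_lt_bot
  | coe b =>
    rw [← h3, ← h6, ← chainDes_snoc c b hab]
    exact hτ b d _ h4 h5 (by rw [RelSeries.head_snoc, h1]) (RelSeries.last_snoc _ _ _)

end Descents

/-! ### Division with remainder in `(0, t]` -/

section UpperDivision

/-- The quotient in the division of `x ≥ 0` by `t` with remainder in `(0, t]`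
(remainder and quotient `0` for `x = 0`). -/
def upperQuot (t : ℕ) (x : ℤ) : ℤ :=
  max 0 ((x - 1) / t)

variable {t : ℕ} {x : ℤ}

lemma upperQuot_nonneg : 0 ≤ upperQuot t x := le_max_left _ _

lemma upperQuot_spec (ht : 1 ≤ t) (hx : 0 ≤ x) :
    0 ≤ x - t * upperQuot t x ∧ x - t * upperQuot t x ≤ t ∧
      (x - t * upperQuot t x = 0 → upperQuot t x = 0) := by
  have ht' : (0 : ℤ) < t := by exact_mod_cast ht
  have h1 := Int.emod_add_mul_ediv (x - 1) t
  have h2 := Int.emod_nonneg (x - 1) ht'.ne'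
  have h3 := Int.emod_lt_of_pos (x - 1) ht'
  rcases hx.eq_or_lt with rfl | hx
  -- Here `(0 - 1) / t` rounds down to a negative number, which the maximum with 0 replaces by 0.
  · have : upperQuot t 0 = 0 := max_eq_left (Int.le_of_lt_add_one (by
      rw [zero_add]; exact Int.ediv_lt_of_lt_mul ht' (by omega)))
    simp [this]
  · have : upperQuot t x = (x - 1) / t := max_eq_right (Int.ediv_nonneg (by omega) ht'.le)
    rw [this]
    refine ⟨by omega, by omega, fun h => by omega⟩

/-- Both remainders 0 and `t` are allowed, so two quotients could differ by one. The clause that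
remainder 0 forces quotient 0 removes this ambiguity. -/
lemma eq_of_remainder_bounds {q q' : ℤ} (ht : 1 ≤ t)
    (hq : 0 ≤ q) (h1 : 0 ≤ x - t * q) (h2 : x - t * q ≤ t) (h3 : x - t * q = 0 → q = 0)
    (hq' : 0 ≤ q') (h1' : 0 ≤ x - t * q') (h2' : x - t * q' ≤ t) (h3' : x - t * q' = 0 → q' = 0) :
    q = q' := by
  have ht' : (0 : ℤ) < t := by exact_mod_cast ht
  have main : ∀ a b : ℤ, 0 ≤ b → 0 ≤ x - t * a → (x - t * a = 0 → a = 0) →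
      x - t * b ≤ t → a ≤ b := by
    intro a b hb ha ha0 hbt
    by_contra! hlt
    have : (t : ℤ) * (b + 1) ≤ t * a := mul_le_mul_of_nonneg_left hlt ht'.le
    have : a = 0 := ha0 (by linarith)
    omega
  exact le_antisymm (main q q' hq' h1 h3 h2') (main q' q hq h1' h3' h2)

lemma upperQuot_eq {q : ℤ} (ht : 1 ≤ t) (hq : 0 ≤ q) (h1 : 0 ≤ x - t * q) (h2 : x - t * q ≤ t)
    (h3 : x - t * q = 0 → q = 0) : upperQuot t x = q := by
  have hx : 0 ≤ x := by
    have : 0 ≤ (t : ℤ) * q := by positivity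
    linarith
  obtain ⟨h4, h5, h6⟩ := upperQuot_spec ht hx
  exact eq_of_remainder_bounds ht upperQuot_nonneg h4 h5 h6 hq h1 h2 h3

lemma upperQuot_eq_zero_iff (ht : 1 ≤ t) (hx : 0 ≤ x) : upperQuot t x = 0 ↔ x ≤ t := by
  constructor
  · intro h
    have := (upperQuot_spec ht hx).2.1
    simpa [h] using this
  · intro h
    exact upperQuot_eq ht le_rfl (by simpa) (by simpa) fun _ => rfl

lemma upperQuot_eq_iff_of_pos {q : ℤ} (ht : 1 ≤ t) (hq : 0 < q) (hx : 0 ≤ x) :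
    upperQuot t x = q ↔ t * q < x ∧ x ≤ t * (q + 1) := by
  constructor
  · rintro rfl
    obtain ⟨h1, h2, h3⟩ := upperQuot_spec ht hx
    refine ⟨lt_of_le_of_ne (by linarith) fun h => ?_, by linarith⟩
    exact hq.ne' (h3 (by linarith))
  · rintro ⟨h1, h2⟩
    exact upperQuot_eq ht hq.le (by linarith) (by linarith) fun h => by linarith

end UpperDivision

/-! ### Permutations as sortings of `WithBot P` -/

section Positions

variable {P : Type*} {n : ℕ} (ω : P ≃ Fin n) (τ : Equiv.Perm (Fin n))

@[simp] lemma hatLabel_bot (ℓ : P → Fin n) : hatLabel ℓ ⊥ = 0 := rfl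

@[simp] lemma hatLabel_coe (ℓ : P → Fin n) (a : P) :
    hatLabel ℓ (a : WithBot P) = (ℓ a : ℕ) + 1 := rfl

lemma hatLabel_injective {ℓ : P → Fin n} (hℓ : Function.Injective ℓ) :
    Function.Injective (hatLabel ℓ) := by
  intro a b h
  cases a <;> cases b <;> simp_all
  exact hℓ (Fin.ext h)

/-- The element of `WithBot P` in position `i` of the word of `τ`. -/
def atPosition (i : Fin (n + 1)) : WithBot P :=
  (Fin.cons ⊥ fun i => ((ω.symm (τ.symm i) : P) : WithBot P) : Fin (n + 1) → WithBot P) i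

@[simp] lemma atPosition_zero : atPosition ω τ 0 = ⊥ := rfl

@[simp] lemma atPosition_succ (i : Fin n) :
    atPosition ω τ i.succ = (ω.symm (τ.symm i) : P) := rfl

@[simp] lemma permVal_atPosition (i : Fin (n + 1)) : permVal ω τ (atPosition ω τ i) = i := by
  induction i using Fin.cases <;> simp [permVal]

lemma atPosition_surjective : Function.Surjective (atPosition ω τ) := by
  intro a
  cases a with
  | bot => exact ⟨0, rfl⟩
  | coe a => exact ⟨(τ (ω a)).succ, by simp⟩

lemma atPosition_injective : Function.Injective (atPosition ω τ) := by
  intro i j h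
  have := congrArg (permVal ω τ) h
  simpa [Fin.ext_iff] using this

/-- The elements of `WithBot P` are ordered by `permVal ω τ` as they are by `key`. -/
def IsSortedBy {K : Type*} [LT K] (key : WithBot P → K) : Prop :=
  ∀ a b : WithBot P, permVal ω τ a < permVal ω τ b ↔ key a < key b

lemma isSortedBy_iff_forall_succ {K : Type*} [LinearOrder K] (key : WithBot P → K) :
    IsSortedBy ω τ key ↔
      ∀ i : Fin n, key (atPosition ω τ i.castSucc) < key (atPosition ω τ i.succ) := by
  constructor
  · intro h i
    rw [← h, permVal_atPosition, permVal_atPosition]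
    exact i.castSucc_lt_succ
  · intro h
    have hmono : StrictMono fun i => key (atPosition ω τ i) := Fin.strictMono_iff_lt_succ.2 h
    intro a b
    obtain ⟨i, rfl⟩ := atPosition_surjective ω τ a
    obtain ⟨j, rfl⟩ := atPosition_surjective ω τ b
    rw [permVal_atPosition, permVal_atPosition]
    exact (hmono.lt_iff_lt (a := i) (b := j)).symm

variable {ω τ} in
lemma IsSortedBy.le_iff {K : Type*} [LinearOrder K] {key : WithBot P → K}
    (h : IsSortedBy ω τ key) (a b : WithBot P) :
    permVal ω τ a ≤ permVal ω τ b ↔ key a ≤ key b := by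
  rw [← not_lt, ← not_lt, h]

/-- The bottom has `permVal` 0, so its key has to be the smallest. The ranks of the other keys
define the permutation. -/
lemma exists_isSortedBy [Fintype P] {K : Type*} [LinearOrder K] {key : WithBot P → K}
    (hinj : Function.Injective key) (hbot : ∀ a : P, key ⊥ < key a) :
    ∃ τ : Equiv.Perm (Fin n), IsSortedBy ω τ key := by
  classical
  have hcard : Fintype.card P = n := by simpa using Fintype.card_congr ω
  have hinj' : Function.Injective fun a : P => key a :=
    hinj.comp WithBot.coe_injective
  have hcard' : Fintype.card (Set.range fun a : P => key a) = n := by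
    rw [Set.card_range_of_injective hinj', hcard]
  let e := Fintype.orderIsoFinOfCardEq (Set.range fun a : P => key a) hcard'
  let τ : Equiv.Perm (Fin n) :=
    ω.symm.trans ((Equiv.ofInjective _ hinj').trans e.symm.toEquiv)
  have hτ : ∀ a : P, τ (ω a) = e.symm (Equiv.ofInjective _ hinj' a) := by
    intro a
    simp [τ]
  refine ⟨τ, fun a b => ?_⟩
  cases a with
  | bot =>
    cases b with
    | bot => simp
    | coe b => simp [permVal, hbot]
  | coe a =>
    cases b with
    | bot => simpa [permVal] using (hbot a).le
    | coe b =>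
      simp only [permVal, hatLabel_coe, add_lt_add_iff_right, Fin.val_fin_lt, hτ, OrderIso.lt_iff_lt]
      rfl

/-- The permutation `σ * τ⁻¹` preserves the order of `Fin n`, whose only order automorphism is the
identity. -/
lemma IsSortedBy.unique {K : Type*} [LinearOrder K] {key : WithBot P → K} {τ σ : Equiv.Perm (Fin n)}
    (hτ : IsSortedBy ω τ key) (hσ : IsSortedBy ω σ key) : τ = σ := by
  have hmono : StrictMono (σ * τ⁻¹ : Equiv.Perm (Fin n)) := by
    intro i j hij
    have h1 := (hτ (ω.symm (τ⁻¹ i) : P) (ω.symm (τ⁻¹ j) : P)).1 (by simpa [permVal] using hij)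
    simpa [permVal] using (hσ _ _).2 h1
  have : ∀ i, (σ * τ⁻¹ : Equiv.Perm (Fin n)) i = i := by
    intro i
    have := Subsingleton.elim
      (hmono.orderIsoOfSurjective _ (σ * τ⁻¹ : Equiv.Perm (Fin n)).surjective) (OrderIso.refl _)
    exact congrArg (fun f : Fin n ≃o Fin n => f i) this
  ext i
  have := this (τ i)
  simp at this
  rw [this]

end Positions

/-! ### The sorting key -/

section Keys

variable {P : Type*} {n : ℕ} (ω : P ≃ Fin n)

/-- The sorting key of an element: remainders increase; equal remainders are sorted by decreasing
quotient and then by increasing label. -/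
def sortKey (r q : WithBot P → ℤ) (a : WithBot P) : ℤ ×ₗ ℤ ×ₗ ℕ :=
  toLex (r a, toLex (-q a, hatLabel ω a))

variable {ω}

lemma sortKey_lt_iff {r q : WithBot P → ℤ} {a b : WithBot P} :
    sortKey ω r q a < sortKey ω r q b ↔
      r a < r b ∨ r a = r b ∧ (q b < q a ∨ q a = q b ∧ hatLabel ω a < hatLabel ω b) := by
  simp [sortKey, Prod.Lex.toLex_lt_toLex]

lemma sortKey_injective (r q : WithBot P → ℤ) : Function.Injective (sortKey ω r q) := by
  intro a b h
  simp only [sortKey, toLex_inj, Prod.mk.injEq] at h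
  exact hatLabel_injective ω.injective h.2.2

/-- Separates the weak inequality of remainders from the condition that makes it strict, which has
the form of the condition in `posetStat`. -/
lemma sortKey_lt_iff_of_ne {r q : WithBot P → ℤ} {a b : WithBot P} (hab : a ≠ b) :
    sortKey ω r q a < sortKey ω r q b ↔
      r a ≤ r b ∧ ((q a < q b ∨ q a = q b ∧ hatLabel ω b < hatLabel ω a) → r a < r b) := by
  have := (hatLabel_injective ω.injective).ne hab
  rw [sortKey_lt_iff]
  omega

lemma le_of_sortKey_le {r q : WithBot P → ℤ} {a b : WithBot P}
    (h : sortKey ω r q a ≤ sortKey ω r q b) : r a ≤ r b := by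
  rcases h.eq_or_lt with h | h
  · rw [sortKey_injective r q h]
  · rw [sortKey_lt_iff] at h
    omega

end Keys

/-! ### The statistic as a number of strict steps -/

section StrictSteps

variable {P : Type*} [PartialOrder P] {n : ℕ} (ω : P ≃ Fin n) (τ : Equiv.Perm (Fin n))

open Classical in
/-- The steps of the word of `τ` that are counted by `posetStat`. -/
noncomputable def strictSteps : Finset (Fin n) :=
  Finset.univ.filter fun i =>
    desAt ω τ (atPosition ω τ i.castSucc) < desAt ω τ (atPosition ω τ i.succ) ∨
      (desAt ω τ (atPosition ω τ i.castSucc) = desAt ω τ (atPosition ω τ i.succ) ∧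
        hatLabel ω (atPosition ω τ i.succ) < hatLabel ω (atPosition ω τ i.castSucc))

lemma posetStat_eq_card : posetStat ω τ = (strictSteps ω τ).card := by
  have hinj : Function.Injective fun i : Fin n =>
      (atPosition ω τ i.castSucc, atPosition ω τ i.succ) := by
    intro i j h
    exact Fin.succ_injective _ (atPosition_injective ω τ (congrArg Prod.snd h))
  rw [← Set.ncard_coe_finset, ← Set.ncard_image_of_injective _ hinj, posetStat]
  congr 1
  ext ⟨a, b⟩
  simp only [Set.mem_ofPred_eq, Set.mem_image, Finset.mem_coe, strictSteps, Finset.mem_filter,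
    Finset.mem_univ, true_and, Prod.mk.injEq]
  constructor
  · rintro ⟨h1, h2⟩
    obtain ⟨i, rfl⟩ := atPosition_surjective ω τ a
    obtain ⟨j, rfl⟩ := atPosition_surjective ω τ b
    rw [permVal_atPosition, permVal_atPosition] at h1
    induction j using Fin.cases with
    | zero => simp at h1
    | succ j =>
      have : i = j.castSucc := Fin.ext (by simpa using h1)
      subst this
      exact ⟨j, h2, rfl, rfl⟩
  · rintro ⟨i, h, rfl, rfl⟩
    exact ⟨by rw [permVal_atPosition, permVal_atPosition]; simp, h⟩

lemma posetStat_le : posetStat ω τ ≤ n := by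
  rw [posetStat_eq_card]
  simpa using (strictSteps ω τ).card_le_univ

end StrictSteps

/-! ### Lattice points with a given sorting permutation -/

section Fibers

variable {P : Type*} {n : ℕ}

/-- Quotients of the values of `v`. -/
def hatQuot (t : ℕ) (v : P → ℤ) (a : WithBot P) : ℤ := upperQuot t (extendZero v a)

/-- Remainders of the values of `v`. -/
def hatRem (t : ℕ) (v : P → ℤ) (a : WithBot P) : ℤ := extendZero v a - t * hatQuot t v a

@[simp] lemma hatQuot_bot {t : ℕ} {v : P → ℤ} (ht : 1 ≤ t) : hatQuot t v ⊥ = 0 :=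
  (upperQuot_eq_zero_iff ht le_rfl).2 (by simp)

lemma hatRem_bot {t : ℕ} {v : P → ℤ} (ht : 1 ≤ t) : hatRem t v ⊥ = 0 := by
  simp [hatRem, ht]

lemma extendZero_atPosition {ω : P ≃ Fin n} (τ : Equiv.Perm (Fin n)) (x : Fin n → ℤ) (j : Fin (n + 1)) :
    extendZero (fun a => x (τ (ω a))) (atPosition ω τ j) = (Fin.cons 0 x : Fin (n + 1) → ℤ) j := by
  induction j using Fin.cases <;> simp

variable [PartialOrder P] (ω : P ≃ Fin n)

/-- The lattice point with quotients `desAt ω τ` and remainders given by `x`. -/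
noncomputable def assemble (τ : Equiv.Perm (Fin n)) (t : ℕ) (x : Fin n → ℤ) (a : P) : ℤ :=
  t * desAt ω τ a + x (τ (ω a))

lemma assemble_injective (τ : Equiv.Perm (Fin n)) (t : ℕ) :
    Function.Injective (assemble ω τ t) := by
  intro x y h
  funext i
  simpa [assemble] using congrFun h (ω.symm (τ.symm i))

variable {ω}

lemma extendZero_assemble (τ : Equiv.Perm (Fin n)) (t : ℕ) (x : Fin n → ℤ) (a : WithBot P) :
    extendZero (assemble ω τ t x) a =
      t * desAt ω τ a + extendZero (fun a => x (τ (ω a))) a := by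
  cases a with
  | bot => simp [desAt_bot]
  | coe a => rfl

lemma mem_boundedSeqs_strictSteps_iff (τ : Equiv.Perm (Fin n)) (t : ℕ) (x : Fin n → ℤ) :
    x ∈ boundedSeqs (strictSteps ω τ) t ↔
      IsSortedBy ω τ (sortKey ω (extendZero fun a => x (τ (ω a))) fun a => (desAt ω τ a : ℤ)) ∧
      extendZero (fun a => x (τ (ω a))) (atPosition ω τ (Fin.last n)) ≤ t := by
  rw [isSortedBy_iff_forall_succ, extendZero_atPosition, boundedSeqs, Set.mem_ofPred_eq]
  refine and_congr_left fun _ => forall_congr' fun i => ?_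
  rw [sortKey_lt_iff_of_ne ((atPosition_injective ω τ).ne i.castSucc_lt_succ.ne),
    extendZero_atPosition, extendZero_atPosition]
  simp [strictSteps]

lemma extendZero_bounds {τ : Equiv.Perm (Fin n)} {t : ℕ} {x : Fin n → ℤ}
    (hx : x ∈ boundedSeqs (strictSteps ω τ) t) (a : WithBot P) :
    0 ≤ extendZero (fun a => x (τ (ω a))) a ∧ extendZero (fun a => x (τ (ω a))) a ≤ t := by
  obtain ⟨h1, h2⟩ := (mem_boundedSeqs_strictSteps_iff τ t x).1 hx
  constructor
  · exact le_of_sortKey_le ((h1.le_iff ⊥ a).1 (Nat.zero_le _))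
  · refine le_trans (le_of_sortKey_le ((h1.le_iff _ _).1 ?_)) h2
    obtain ⟨i, rfl⟩ := atPosition_surjective ω τ a
    rw [permVal_atPosition, permVal_atPosition]
    exact Fin.le_last i

/-- Assembling and dividing are inverse: the sequence satisfies the remainder conditions, and these
determine the division. -/
lemma hat_assemble {τ : Equiv.Perm (Fin n)} {t : ℕ} {x : Fin n → ℤ} (ht : 1 ≤ t)
    (hx : x ∈ boundedSeqs (strictSteps ω τ) t) :
    (hatQuot t (assemble ω τ t x) = fun a => (desAt ω τ a : ℤ)) ∧
      hatRem t (assemble ω τ t x) = extendZero fun a => x (τ (ω a)) := by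
  have h1 := ((mem_boundedSeqs_strictSteps_iff τ t x).1 hx).1
  have hquot : hatQuot t (assemble ω τ t x) = fun a => (desAt ω τ a : ℤ) := by
    funext a
    obtain ⟨hbot, hlast⟩ := extendZero_bounds hx a
    refine upperQuot_eq ht (Int.natCast_nonneg _) ?_ ?_ ?_ <;>
      rw [extendZero_assemble, add_sub_cancel_left]
    · exact hbot
    · exact hlast
    · intro h0
      cases a with
      | bot => simp [desAt_bot]
      | coe a =>
        -- The bottom has remainder and quotient 0 and comes first in the sorting; among elements of
        -- remainder 0 quotients decrease, so that of `a` is at most 0.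
        have := (h1 ⊥ a).1 (Nat.succ_pos _)
        rw [sortKey_lt_iff, h0, extendZero_bot, desAt_bot] at this
        omega
  refine ⟨hquot, ?_⟩
  funext a
  rw [hatRem, hquot, extendZero_assemble]
  ring

section

variable [Finite P] {t : ℕ} {v : P → ℤ}

lemma IsLatticeLipschitz.nonneg (hv : IsLatticeLipschitz t v) (a : WithBot P) :
    0 ≤ extendZero v a := by
  have hfin : Finite (WithBot P) := inferInstanceAs (Finite (Option P))
  obtain ⟨c, h1, rfl⟩ := exists_satChain (bot_le : ⊥ ≤ a)
  have := Fin.sum_succ_sub_castSucc fun i => extendZero v (c i)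
  have h2 : extendZero v (c 0) = 0 := congrArg (extendZero v) h1
  rw [h2, sub_zero] at this
  exact (Finset.sum_nonneg fun i _ => (hv _ _ (c.step i)).1).trans this.le

lemma IsLatticeLipschitz.rem_spec (hv : IsLatticeLipschitz t v) (ht : 1 ≤ t) (a : WithBot P) :
    0 ≤ hatRem t v a ∧ hatRem t v a ≤ t ∧ (hatRem t v a = 0 → hatQuot t v a = 0) :=
  upperQuot_spec ht (hv.nonneg a)

lemma IsLatticeLipschitz.bot_lt (hv : IsLatticeLipschitz t v) (ht : 1 ≤ t) (a : P) :
    sortKey ω (hatRem t v) (hatQuot t v) ⊥ < sortKey ω (hatRem t v) (hatQuot t v) a := by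
  obtain ⟨h1, -, h3⟩ := hv.rem_spec ht a
  rw [sortKey_lt_iff, hatRem_bot ht, hatQuot_bot ht]
  rcases h1.eq_or_lt with h | h
  · exact Or.inr ⟨h, Or.inr ⟨(h3 h.symm).symm, by simp⟩⟩
  · exact Or.inl h

/-- The tie-breaking rules of the key are chosen for this. If `q b = q a`, then `r a ≤ r b`, and a
tie is resolved by the natural labeling in favor of `a`. If `q b = q a + 1`, then `r b ≤ r a`, and a
tie is resolved by the larger quotient in favor of `b`. -/
lemma IsLatticeLipschitz.quot_step (hv : IsLatticeLipschitz t v) (ht : 1 ≤ t)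
    (hω : StrictMono ω) {τ : Equiv.Perm (Fin n)}
    (hτ : IsSortedBy ω τ (sortKey ω (hatRem t v) (hatQuot t v))) {a b : WithBot P} (hab : a ⋖ b) :
    hatQuot t v b = hatQuot t v a + desStep ω τ a b := by
  have ht' : (0 : ℤ) < t := by exact_mod_cast ht
  obtain ⟨a1, a2, a3⟩ := hv.rem_spec ht a
  obtain ⟨b1, b2, b3⟩ := hv.rem_spec ht b
  have a4 : 0 ≤ hatQuot t v a := upperQuot_nonneg
  have b4 : 0 ≤ hatQuot t v b := upperQuot_nonneg
  obtain ⟨c1, c2⟩ := hv a b hab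
  have hlab : hatLabel ω a < hatLabel ω b := by
    cases b with
    | bot => exact absurd hab.lt not_lt_bot
    | coe b =>
      cases a with
      | bot => simp
      | coe a => simpa using hω (WithBot.coe_lt_coe.1 hab.lt)
  have hdiff : extendZero v b - extendZero v a =
      t * (hatQuot t v b - hatQuot t v a) + (hatRem t v b - hatRem t v a) := by
    simp only [hatRem]
    ring
  have hτ' := hτ b a
  rw [sortKey_lt_iff] at hτ'
  set d := hatQuot t v b - hatQuot t v a with hd
  rw [hdiff] at c1 c2
  -- A jump outside `{0, 1}` would need remainders differing by at least `t`, so the smaller one is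
  -- 0. Its quotient is then 0, which contradicts the direction of the jump.
  have hd0 : 0 ≤ d := by
    by_contra! h
    have : (t : ℤ) * d ≤ t * (-1) := mul_le_mul_of_nonneg_left (by omega) ht'.le
    have := a3 (by linarith)
    omega
  have hd1 : d ≤ 1 := by
    by_contra! h
    have : (t : ℤ) * 2 ≤ t * d := mul_le_mul_of_nonneg_left (by omega) ht'.le
    have := b3 (by linarith)
    omega
  unfold desStep
  rcases (by omega : d = 0 ∨ d = 1) with h | h
  · rw [h] at c1
    rw [if_neg]
    · simp; omega
    · rw [hτ']
      omega
  · rw [h] at c2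
    rw [if_pos]
    · simp; omega
    · rw [hτ']
      omega

/-- At a descent the difference is `t` minus a drop of remainders, at a non-descent it is a rise of
remainders. Drop and rise both lie in `[0, t]`. -/
lemma isLatticeLipschitz_assemble {τ : Equiv.Perm (Fin n)} {x : Fin n → ℤ}
    (hτ : IsDescentCompatible ω τ) (hx : x ∈ boundedSeqs (strictSteps ω τ) t) :
    IsLatticeLipschitz t (assemble ω τ t x) := by
  have h1 := ((mem_boundedSeqs_strictSteps_iff τ t x).1 hx).1
  intro a b hab
  rw [extendZero_assemble, extendZero_assemble, hτ.desAt_step hab]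
  obtain ⟨a1, a2⟩ := extendZero_bounds hx a
  obtain ⟨b1, b2⟩ := extendZero_bounds hx b
  unfold desStep
  split_ifs with h
  · have := le_of_sortKey_le ((h1 _ _).1 h).le
    push_cast
    constructor <;> linarith
  · have := le_of_sortKey_le ((h1.le_iff _ _).1 (not_lt.1 h))
    push_cast
    constructor <;> linarith

/-- The lattice points sorted by `τ` are parametrized by bounded sequences if `τ` is
descent-compatible with the right number of descents, and do not exist otherwise. -/
lemma isSortedBy_iff_mem_image [OrderTop P] (ht : 1 ≤ t) (hω : StrictMono ω) (j : ℕ)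
    (τ : Equiv.Perm (Fin n)) :
    ((IsLatticeLipschitz t v ∧ upperQuot t (v ⊤) = j) ∧
        IsSortedBy ω τ (sortKey ω (hatRem t v) (hatQuot t v))) ↔
      τ ∈ descentClass ω j ∧ v ∈ assemble ω τ t '' boundedSeqs (strictSteps ω τ) t := by
  simp only [descentClass, Finset.mem_filter, Finset.mem_univ, true_and]
  constructor
  · rintro ⟨⟨hv, hj⟩, hs⟩
    have hstep : ∀ a b : WithBot P, a ⋖ b → hatQuot t v b = hatQuot t v a + desStep ω τ a b :=
      fun a b hab => hv.quot_step ht hω hs hab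
    have hdes : ∀ a, (desAt ω τ a : ℤ) = hatQuot t v a := desAt_eq_of_step (hatQuot_bot ht) hstep
    have htop : posetDes ω τ = j := by
      have h := hdes (⊤ : P)
      have h' : hatQuot t v (⊤ : P) = j := hj
      rw [h'] at h
      exact_mod_cast h
    refine ⟨⟨isDescentCompatible_of_step hstep, htop⟩,
      fun i => hatRem t v (ω.symm (τ.symm i) : P), ?_, ?_⟩
    · have hrem : (extendZero fun a : P => hatRem t v ((ω.symm (τ.symm (τ (ω a))) : P))) =
          hatRem t v := by
        funext a
        cases a with
        | bot => simp [hatRem_bot ht]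
        | coe a => simp
      rw [mem_boundedSeqs_strictSteps_iff, hrem, funext hdes]
      exact ⟨hs, (hv.rem_spec ht _).2.1⟩
    · funext a
      simp [assemble, hdes, hatRem]
  · rintro ⟨⟨hdc, hj⟩, x, hx, rfl⟩
    obtain ⟨hq, hr⟩ := hat_assemble ht hx
    refine ⟨⟨isLatticeLipschitz_assemble hdc hx, ?_⟩, ?_⟩
    · have := congrFun hq (⊤ : P)
      rw [← hj]
      exact this
    · rw [hq, hr]
      exact ((mem_boundedSeqs_strictSteps_iff τ t x).1 hx).1

end

/-- Every point has exactly one sorting permutation, so the images of the sequence sets partition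
the points. -/
lemma ncard_latticePoints [Fintype P] [OrderTop P] {t : ℕ} (ht : 1 ≤ t) (hω : StrictMono ω)
    (j : ℕ) :
    {v : P → ℤ | IsLatticeLipschitz t v ∧ upperQuot t (v ⊤) = j}.Finite ∧
    {v : P → ℤ | IsLatticeLipschitz t v ∧ upperQuot t (v ⊤) = j}.ncard =
      ∑ τ ∈ descentClass ω j, (t + n - posetStat ω τ).choose n := by
  classical
  set A := {v : P → ℤ | IsLatticeLipschitz t v ∧ upperQuot t (v ⊤) = j}
  have hfin : ∀ τ : Equiv.Perm (Fin n),
      (assemble ω τ t '' boundedSeqs (strictSteps ω τ) t).Finite :=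
    fun τ => (ncard_boundedSeqs _ t).1.image _
  have hunion : A = ⋃ τ ∈ descentClass ω j,
      assemble ω τ t '' boundedSeqs (strictSteps ω τ) t := by
    ext v
    simp only [Set.mem_iUnion, exists_prop]
    constructor
    · intro hv
      obtain ⟨τ, hτ⟩ := exists_isSortedBy ω (sortKey_injective (hatRem t v) (hatQuot t v))
        fun a => hv.1.bot_lt ht a
      exact ⟨τ, (isSortedBy_iff_mem_image ht hω j τ).1 ⟨hv, hτ⟩⟩
    · rintro ⟨τ, hτ⟩
      exact ((isSortedBy_iff_mem_image ht hω j τ).2 hτ).1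
  have hcard : ∀ τ, (hfin τ).toFinset.card = (t + n - posetStat ω τ).choose n := by
    intro τ
    rw [← Set.ncard_eq_toFinset_card _ (hfin τ), Set.ncard_image_of_injective _ (assemble_injective ω τ t),
      (ncard_boundedSeqs _ t).2, posetStat_eq_card]
  have hunion' : A = ((descentClass ω j).biUnion fun τ => (hfin τ).toFinset : Finset (P → ℤ)) := by
    rw [hunion]
    ext v
    simp
  constructor
  · rw [hunion']
    exact Finset.finite_toSet _
  · rw [hunion', Set.ncard_coe_finset, Finset.card_biUnion]
    · exact Finset.sum_congr rfl fun τ _ => hcard τ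
    · intro τ hτ σ hσ hne
      refine Finset.disjoint_left.2 ?_
      intro v h1 h2
      rw [Set.Finite.mem_toFinset] at h1 h2
      exact hne (IsSortedBy.unique ω ((isSortedBy_iff_mem_image ht hω j τ).2 ⟨hτ, h1⟩).2
        ((isSortedBy_iff_mem_image ht hω j σ).2 ⟨hσ, h2⟩).2)

end Fibers

/-! ### Slices as level sets of the quotient at the top -/

section Hypersimplices

variable {P : Type*} [Fintype P] [PartialOrder P] [OrderTop P]

lemma isHStarPolynomial_of_mem_iff {n : ℕ} (ω : P ≃ Fin n) (hω : StrictMono ω)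
    (A : Set (P → ℝ)) (j : ℕ)
    (hA : ∀ t : ℕ, 1 ≤ t → ∀ v : P → ℤ, v ∈ dilateLatticePoints A t ↔
      IsLatticeLipschitz t v ∧ upperQuot t (v ⊤) = j) :
    IsHStarPolynomial A
      (∑ τ ∈ descentClass ω j, (Polynomial.X : Polynomial ℚ) ^ posetStat ω τ) := by
  have hn : Fintype.card P = n := by simpa using Fintype.card_congr ω
  refine isHStarPolynomial_of_ncard A _ _ (fun τ _ => hn ▸ posetStat_le ω τ) fun t ht => ?_
  rw [hn, show dilateLatticePoints A t =
    {v : P → ℤ | IsLatticeLipschitz t v ∧ upperQuot t (v ⊤) = j} from Set.ext (hA t ht)]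
  exact ncard_latticePoints ht hω j

/-- Quotient 0 is the only one that allows remainder 0, which is why this slice is closed below. -/
lemma mem_dilate_hypersimplex_one_iff {t : ℕ} (ht : 1 ≤ t) (v : P → ℤ) :
    v ∈ dilateLatticePoints (hypersimplex P 1) t ↔
      IsLatticeLipschitz t v ∧ upperQuot t (v ⊤) = (0 : ℕ) := by
  have ht0 : (0 : ℝ) < t := by exact_mod_cast ht
  rw [mem_dilateLatticePoints_iff _ ht, hypersimplex, Set.mem_ofPred_eq,
    inv_smul_mem_lipPolytope_iff ht]
  refine and_congr_right fun hv => ?_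
  have h0 : 0 ≤ v ⊤ := hv.nonneg (⊤ : P)
  have h0' : (0 : ℝ) ≤ v ⊤ := by exact_mod_cast h0
  rw [Nat.cast_zero, upperQuot_eq_zero_iff ht h0, Pi.smul_apply, smul_eq_mul, ← div_eq_inv_mul,
    Nat.cast_one, sub_self, div_le_one ht0]
  constructor
  · rintro ⟨-, h⟩
    exact_mod_cast h
  · intro h
    exact ⟨by positivity, by exact_mod_cast h⟩

lemma mem_dilate_halfOpenHypersimplex_iff {t k : ℕ} (ht : 1 ≤ t) (hk : 2 ≤ k) (v : P → ℤ) :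
    v ∈ dilateLatticePoints (halfOpenHypersimplex P k) t ↔
      IsLatticeLipschitz t v ∧ upperQuot t (v ⊤) = (k - 1 : ℕ) := by
  have ht0 : (0 : ℝ) < t := by exact_mod_cast ht
  rw [mem_dilateLatticePoints_iff _ ht, halfOpenHypersimplex, Set.mem_ofPred_eq,
    inv_smul_mem_lipPolytope_iff ht]
  refine and_congr_right fun hv => ?_
  have h0 : 0 ≤ v ⊤ := hv.nonneg (⊤ : P)
  rw [upperQuot_eq_iff_of_pos ht (by omega) h0, Pi.smul_apply, smul_eq_mul,
    ← div_eq_inv_mul, lt_div_iff₀' ht0, div_le_iff₀' ht0, Nat.cast_sub (by omega : 1 ≤ k),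
    Nat.cast_one, sub_add_cancel]
  norm_cast

end Hypersimplices

theorem corollary5p7 {P : Type*} [Fintype P] [PartialOrder P] [OrderTop P] {n : ℕ}
    (ω : P ≃ Fin n) (hω : StrictMono ω) :
    IsHStarPolynomial (hypersimplex P 1)
        (∑ τ ∈ descentClass ω 0, (Polynomial.X : Polynomial ℚ) ^ posetStat ω τ) ∧
      ∀ k : ℕ, 2 ≤ k → (k : ℕ∞) ≤ posetHeight P →
        IsHStarPolynomial (halfOpenHypersimplex P k)
          (∑ τ ∈ descentClass ω (k - 1), (Polynomial.X : Polynomial ℚ) ^ posetStat ω τ) :=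
  ⟨isHStarPolynomial_of_mem_iff ω hω _ 0 fun _ ht v => mem_dilate_hypersimplex_one_iff ht v,
    fun k hk _ => isHStarPolynomial_of_mem_iff ω hω _ (k - 1) fun _ ht v =>
      mem_dilate_halfOpenHypersimplex_iff ht hk v⟩
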